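/- Let $G$ be a locally compact, second countable Hausdorff topological group and let $A$ be a locally compact, second countable Hausdorff abelian topological group, written additively, on which $G$ acts by group automorphisms so that the action map $G\times A\to A$ is continuous. For $n\ge 0$ let $C^n_{lcm}(G,A)$ be the group of Borel measurable functions $f\colon G^n\to A$ that are continuous on some neighbourhood of the identity of $G^n$ (so $C^0_{lcm}(G,A)=A$), with the differential $d^n\colon C^n_{lcm}(G,A)\to C^{n+1}_{lcm}(G,A)$, \[ (d^nf)(s_1,\dots,s_{n+1})=s_1\cdot f(s_2,\dots,s_{n+1})+\sum_{i=1}^{n}(-1)^i f(s_1,\dots,s_is_{i+1},\dots,s_{n+1})+(-1)^{n+1}f(s_1,\dots,s_n). \] Let $Z^n_{lcm}(G,A)=\ker d^n$, let $B^n_{lcm}(G,A)=\operatorname{im} d^{n-1}$ for $n\ge 1$ and $B^0_{lcm}(G,A)=0$, and let $H^n_{lcm}(G,A)=Z^n_{lcm}(G,A)/B^n_{lcm}(G,A)$. A topological extension of $G$ by $A$ is a short exact sequence $1\to A\xrightarrow{\imath}E\xrightarrow{\pi}G\to 1$ of topological groups and continuous homomorphisms with $\imath$ closed and $\pi$ open,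 such that $e\,\imath(a)\,e^{-1}=\imath(\pi(e)\cdot a)$ for all $e\in E$ and $a\in A$. It is locally split if there are an open neighbourhood $U$ of the identity of $G$ and a continuous map $\sigma\colon U\to E$ with $\pi\circ\sigma=\mathrm{id}_U$. Two extensions $E$, $E'$ are isomorphic if there is an isomorphism of topological groups $E\to E'$ compatible with the inclusions of $A$ and the projections to $G$. Then every locally split extension $E$ of $G$ by $A$ has a Borel measurable section $\sigma\colon G\to E$ of $\pi$ that is continuous in a neighbourhood of the identity. For every such $\sigma$ the formula \[ \imath\bigl(f_\sigma(s_1,s_2)\bigr)=\sigma(s_1)\,\sigma(s_2)\,\sigma(s_1s_2)^{-1} \] defines a cocycle $f_\sigma\in Z^2_{lcm}(G,A)$ whose class in $H^2_{lcm}(G,A)$ depends only on the isomorphism class of $E$. The resulting map $[E]\mapsto[f_\sigma]$ is a bijection from the set of isomorphism classes of locally split extensions of $G$ by $A$ onto $H^2_{lcm}(G,A)$. -/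

import Mathlib

open Topology

universe u v

namespace LocallyContinuousCohomology

/-- `f` is Borel measurable, and continuous on some neighbourhood of the identity. -/
def IsLCM {X : Type*} {Y : Type*} [TopologicalSpace X] [One X] [TopologicalSpace Y]
    (f : X → Y) : Prop :=
  @Measurable X Y (borel X) (borel Y) f ∧ ∃ U ∈ 𝓝 (1 : X), ContinuousOn f U

theorem IsLCM.comp {X : Type*} {Y : Type*} {Z : Type*} [TopologicalSpace X] [One X]
    [TopologicalSpace Y] [One Y] [TopologicalSpace Z] {f : Y → Z} {p : X → Y}
    (hf : IsLCM f) (hp : Continuous p) (h1 : p 1 = 1) : IsLCM (fun x => f (p x)) := by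
  obtain ⟨hm, U, hU, hc⟩ := hf
  refine ⟨?_, p ⁻¹' U, hp.continuousAt.preimage_mem_nhds (by rwa [h1]),
    hc.comp hp.continuousOn (fun x hx => hx)⟩
  borelize X Y Z
  exact hm.comp hp.measurable

theorem IsLCM.add {X : Type*} {A : Type*} [TopologicalSpace X] [One X] [TopologicalSpace A]
    [SecondCountableTopology A] [AddCommGroup A] [IsTopologicalAddGroup A] {f g : X → A}
    (hf : IsLCM f) (hg : IsLCM g) : IsLCM (f + g) := by
  obtain ⟨hm, U, hU, hc⟩ := hf
  obtain ⟨hm', V, hV, hc'⟩ := hg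
  refine ⟨?_, U ∩ V, Filter.inter_mem hU hV,
    (hc.mono Set.inter_subset_left).add (hc'.mono Set.inter_subset_right)⟩
  borelize X A
  exact Measurable.add hm hm'

theorem IsLCM.neg {X : Type*} {A : Type*} [TopologicalSpace X] [One X] [TopologicalSpace A]
    [AddCommGroup A] [IsTopologicalAddGroup A] {f : X → A} (hf : IsLCM f) : IsLCM (-f) := by
  obtain ⟨hm, U, hU, hc⟩ := hf
  refine ⟨?_, U, hU, hc.neg⟩
  borelize X A
  exact Measurable.neg hm

theorem IsLCM.zero {X : Type*} {A : Type*} [TopologicalSpace X] [One X] [TopologicalSpace A]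
    [AddCommGroup A] : IsLCM (0 : X → A) := by
  refine ⟨?_, Set.univ, Filter.univ_mem, continuousOn_const⟩
  exact @measurable_const A X (borel A) (borel X) 0

theorem IsLCM.smul {X : Type*} {G : Type*} {A : Type*} [TopologicalSpace X] [One X]
    [TopologicalSpace G] [Group G] [SecondCountableTopology G]
    [TopologicalSpace A] [SecondCountableTopology A] [AddCommGroup A]
    [DistribMulAction G A] [ContinuousSMul G A] {p : X → G} {f : X → A}
    (hp : Continuous p) (hf : IsLCM f) : IsLCM (fun x => p x • f x) := by
  obtain ⟨hm, U, hU, hc⟩ := hf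
  refine ⟨?_, U, hU, hp.continuousOn.smul hc⟩
  borelize X A G
  exact hp.measurable.smul hm

/-! ### The cochain complex -/

/-- The group `C^n_lcm(G, A)` of Borel measurable functions `G^n → A` which are continuous in a
neighbourhood of the identity of `G^n` (for `n = 0` this is `A`). -/
def cochains (G : Type u) (A : Type v) [Group G] [TopologicalSpace G]
    [AddCommGroup A] [TopologicalSpace A] [IsTopologicalAddGroup A] [SecondCountableTopology A]
    (n : ℕ) : AddSubgroup ((Fin n → G) → A) where
  carrier := {f | IsLCM f}
  add_mem' := IsLCM.add
  zero_mem' := IsLCM.zero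
  neg_mem' := IsLCM.neg

/-- The standard coboundary on all functions `G^n → A`:
`(df)(s₁, …, sₙ₊₁) = s₁ • f(s₂, …, sₙ₊₁) + ∑ᵢ (-1)ⁱ f(…, sᵢ sᵢ₊₁, …) + (-1)ⁿ⁺¹ f(s₁, …, sₙ)`.
The last term is the one for `j = n` below, where `Fin.contractNth` drops the last entry. -/
def coboundary {G : Type u} {A : Type v} [Group G] [AddCommGroup A] [DistribMulAction G A]
    {n : ℕ} (f : (Fin n → G) → A) : (Fin (n + 1) → G) → A := fun s =>
  s 0 • f (fun i => s i.succ) +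
    ∑ j : Fin (n + 1), (-1 : ℤ) ^ ((j : ℕ) + 1) • f (Fin.contractNth j (· * ·) s)

theorem coboundary_add {G : Type u} {A : Type v} [Group G] [AddCommGroup A]
    [DistribMulAction G A] {n : ℕ} (f g : (Fin n → G) → A) :
    coboundary (f + g) = coboundary f + coboundary g := by
  funext s
  simp only [coboundary, Pi.add_apply, smul_add, Finset.sum_add_distrib]
  abel

theorem coboundary_coboundary {G : Type u} {A : Type v} [Group G] [AddCommGroup A]
    [DistribMulAction G A] {n : ℕ} (f : (Fin n → G) → A) : coboundary (coboundary f) = 0 := by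
  let V := ULift.{u} A
  let ρ : Representation (ULift.{max u v} ℤ) (ULift.{v} G) V :=
    { toFun := fun g =>
        { toFun := fun a => ⟨g.down • a.down⟩
          map_add' := fun a b => congrArg ULift.up (smul_add g.down a.down b.down)
          map_smul' := fun r a => congrArg ULift.up (smul_comm g.down r.down a.down) }
      map_one' := by ext; simp
      map_mul' := fun g h => by ext; simp [mul_smul] }
  have hcon : ∀ {m : ℕ} (j : Fin (m + 1)) (s : Fin (m + 1) → ULift.{v} G),
      (fun i => (Fin.contractNth j (· * ·) s i).down) =
        Fin.contractNth j (· * ·) (fun i => (s i).down) := by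
    intro m j s
    funext i
    simp only [Fin.contractNth]
    split_ifs <;> rfl
  have key : ∀ {m : ℕ} (f : (Fin m → G) → A),
      (inhomogeneousCochains.d (Rep.of ρ) m).hom
          (fun s : Fin m → ULift.{v} G => (ULift.up (f fun i => (s i).down) : V)) =
        fun s : Fin (m + 1) → ULift.{v} G => (ULift.up (coboundary f fun i => (s i).down) : V) := by
    intro m f
    funext s
    rw [inhomogeneousCochains.d_hom_apply]
    simp only [hcon, coboundary]
    apply ULift.down_injective
    change _ + AddEquiv.ulift _ = _
    rw [map_sum]
    refine congrArg₂ (· + ·) rfl (Finset.sum_congr rfl fun j _ => ?_)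
    have hp : ∀ k : ℕ, ((-1 : ULift.{max u v} ℤ) ^ k).down = (-1 : ℤ) ^ k := fun k =>
      map_pow (ULift.ringEquiv : ULift.{max u v} ℤ ≃+* ℤ) _ k
    rw [← hp]
    rfl
  have h := groupCohomology.inhomogeneousCochains.d_comp_d (n := n) (Rep.of ρ)
  have h2 := congrArg (fun φ => φ.hom
    (fun s : Fin n → ULift.{v} G => (ULift.up (f fun i => (s i).down) : V))) h
  simp only [ModuleCat.hom_comp, LinearMap.comp_apply] at h2
  rw [key, key] at h2
  funext s
  exact congrArg ULift.down (congrFun h2 (fun i => ⟨s i⟩))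

theorem continuous_contractNth {G : Type u} [Group G] [TopologicalSpace G]
    [IsTopologicalGroup G] {n : ℕ} (j : Fin (n + 1)) :
    Continuous (fun s : Fin (n + 1) → G => Fin.contractNth j (· * ·) s) := by
  refine continuous_pi fun k => ?_
  simp only [Fin.contractNth]
  split_ifs <;> fun_prop

theorem contractNth_one {G : Type u} [Group G] {n : ℕ} (j : Fin (n + 1)) :
    Fin.contractNth j (· * ·) (1 : Fin (n + 1) → G) = 1 := by
  funext k
  simp only [Fin.contractNth]
  split_ifs <;> simp

section Complex

variable (G : Type u) (A : Type v) [Group G] [TopologicalSpace G] [IsTopologicalGroup G]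
  [SecondCountableTopology G] [AddCommGroup A] [TopologicalSpace A] [IsTopologicalAddGroup A]
  [SecondCountableTopology A] [DistribMulAction G A] [ContinuousSMul G A]

theorem coboundary_mem (n : ℕ) {f : (Fin n → G) → A} (hf : f ∈ cochains G A n) :
    coboundary f ∈ cochains G A (n + 1) := by
  have hf' : IsLCM f := hf
  have h0 : IsLCM (fun s : Fin (n + 1) → G => s 0 • f (fun i => s i.succ)) :=
    IsLCM.smul (continuous_apply 0) (hf'.comp (by fun_prop) rfl)
  have h1 : ∀ j : Fin (n + 1),
      (fun s : Fin (n + 1) → G => f (Fin.contractNth j (· * ·) s)) ∈ cochains G A (n + 1) :=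
    fun j => hf'.comp (continuous_contractNth j) (contractNth_one j)
  have h2 := (cochains G A (n + 1)).add_mem h0
    ((cochains G A (n + 1)).sum_mem (t := Finset.univ)
      (fun j _ => (cochains G A (n + 1)).zsmul_mem (h1 j) ((-1 : ℤ) ^ ((j : ℕ) + 1))))
  convert h2 using 1
  funext s
  simp [coboundary, Finset.sum_apply]

/-- The differential `d^n : C^n_lcm(G, A) → C^{n+1}_lcm(G, A)`. -/
def d (n : ℕ) : cochains G A n →+ cochains G A (n + 1) :=
  AddMonoidHom.mk' (fun f => ⟨coboundary f.1, coboundary_mem G A n f.2⟩)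
    (fun f g => Subtype.ext (coboundary_add f.1 g.1))

theorem d_d (n : ℕ) (f : cochains G A n) : d G A (n + 1) (d G A n f) = 0 :=
  Subtype.ext (coboundary_coboundary f.1)

/-- The cocycles `Z^n_lcm(G, A)`. -/
def cocycles (n : ℕ) : AddSubgroup (cochains G A n) := (d G A n).ker

/-- The coboundaries `B^n_lcm(G, A)`, with `B^0 = 0`. -/
def coboundaries : (n : ℕ) → AddSubgroup (cochains G A n)
  | 0 => ⊥
  | n + 1 => (d G A n).range

theorem coboundaries_le_cocycles (n : ℕ) : coboundaries G A n ≤ cocycles G A n := by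
  cases n with
  | zero => exact bot_le
  | succ n =>
    rintro _ ⟨f, rfl⟩
    exact d_d G A n f

/-- The cohomology group `H^n_lcm(G, A) = Z^n_lcm(G, A) / B^n_lcm(G, A)`. -/
abbrev H (n : ℕ) : Type (max u v) :=
  cocycles G A n ⧸ (coboundaries G A n).addSubgroupOf (cocycles G A n)

end Complex

/-! ### Locally split topological extensions -/

/-- A topological extension `1 → A → E → G → 1` of `G` by the `G`-module `A`: a short exact
sequence of topological groups and continuous homomorphisms, whose first map is closed and whose
second map is open, such that conjugation in `E` induces the given action of `G` on `A`. -/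
structure TopExtension (G : Type u) (A : Type v) [Group G] [TopologicalSpace G]
    [AddCommGroup A] [TopologicalSpace A] [DistribMulAction G A] where
  /-- The middle group. -/
  E : Type (max u v)
  [group : Group E]
  [topology : TopologicalSpace E]
  [isTopologicalGroup : IsTopologicalGroup E]
  /-- The underlying extension of abstract groups. -/
  ext : GroupExtension (Multiplicative A) E G
  continuous_inl : Continuous ext.inl
  isClosedMap_inl : IsClosedMap ext.inl
  continuous_rightHom : Continuous ext.rightHom
  isOpenMap_rightHom : IsOpenMap ext.rightHom
  conj_inl : ∀ (e : E) (a : A), e * ext.inl (Multiplicative.ofAdd a) * e⁻¹ =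
    ext.inl (Multiplicative.ofAdd (ext.rightHom e • a))

attribute [instance] TopExtension.group TopExtension.topology TopExtension.isTopologicalGroup

namespace TopExtension

variable {G : Type u} {A : Type v} [Group G] [TopologicalSpace G]
  [AddCommGroup A] [TopologicalSpace A] [DistribMulAction G A]

/-- The projection has a continuous section over an open neighbourhood of the identity. -/
def IsLocallySplit (S : TopExtension G A) : Prop :=
  ∃ U : Set G, IsOpen U ∧ 1 ∈ U ∧ ∃ σ : U → S.E, Continuous σ ∧ ∀ s : U, S.ext.rightHom (σ s) = s

/-- Isomorphism of topological extensions: an isomorphism of topological groups inducing the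
identity on `A` and on `G`. -/
def IsIso (S T : TopExtension G A) : Prop :=
  ∃ φ : S.ext.Equiv T.ext, Continuous φ.toMulEquiv ∧ Continuous φ.toMulEquiv.symm

theorem IsIso.refl (S : TopExtension G A) : IsIso S S :=
  ⟨⟨MulEquiv.refl _, rfl, rfl⟩, continuous_id, continuous_id⟩

theorem IsIso.symm {S T : TopExtension G A} (h : IsIso S T) : IsIso T S := by
  obtain ⟨φ, h1, h2⟩ := h
  refine ⟨⟨φ.toMulEquiv.symm, ?_, ?_⟩, h2, h1⟩
  · rw [← φ.inl_comm]
    funext a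
    simp
  · rw [← φ.rightHom_comm]
    funext a
    simp

theorem IsIso.trans {S T R : TopExtension G A} (h : IsIso S T) (h' : IsIso T R) : IsIso S R := by
  obtain ⟨φ, h1, h2⟩ := h
  obtain ⟨ψ, h3, h4⟩ := h'
  refine ⟨⟨φ.toMulEquiv.trans ψ.toMulEquiv, ?_, ?_⟩, h3.comp h1, h2.comp h4⟩
  · rw [← ψ.inl_comm, ← φ.inl_comm]
    rfl
  · rw [← φ.rightHom_comm, ← ψ.rightHom_comm]
    rfl

end TopExtension

section

variable (G : Type u) (A : Type v) [Group G] [TopologicalSpace G]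
  [AddCommGroup A] [TopologicalSpace A] [DistribMulAction G A]

/-- Locally split topological extensions of `G` by `A`. -/
abbrev LocallySplitExtension : Type (max u v + 1) :=
  {S : TopExtension G A // S.IsLocallySplit}

/-- Isomorphism as an equivalence relation on locally split extensions. -/
instance LocallySplitExtension.setoid : Setoid (LocallySplitExtension G A) where
  r S T := TopExtension.IsIso S.1 T.1
  iseqv := ⟨fun S => .refl S.1, fun h => h.symm, fun h h' => h.trans h'⟩

/-- Isomorphism classes of locally split topological extensions of `G` by `A`. -/
abbrev ExtensionClasses : Type (max u v + 1) := Quotient (LocallySplitExtension.setoid G A)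

end

/-- `f` is the factor set of `σ : G → E`:
`f(s₁, s₂) = σ(s₁) σ(s₂) σ(s₁ s₂)⁻¹` under the inclusion `A → E`. -/
def IsFactorSet {G : Type u} {A : Type v} [Group G] [TopologicalSpace G]
    [AddCommGroup A] [TopologicalSpace A] [DistribMulAction G A] (S : TopExtension G A)
    (σ : G → S.E) (f : (Fin 2 → G) → A) : Prop :=
  ∀ s₁ s₂ : G, S.ext.inl (Multiplicative.ofAdd (f ![s₁, s₂])) = σ s₁ * σ s₂ * (σ (s₁ * s₂))⁻¹

end LocallyContinuousCohomology

namespace LocallyContinuousCohomology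

/-! ### Gluing along countable covers -/

/-! A section `σ` gives every element of `E` unique coordinates `incl a * σ s`, in which
multiplication is governed by the factor set. Associativity is the cocycle identity, and changing
`σ` by `β : G → A` adds the coboundary of `β`. Borel sections exist because countably many
translates of a local section cover `G`. If two sections have the same factor set, matching
coordinates is a homomorphism, and its continuity only has to be checked near the identity, where
both sections are continuous (`exists_continuous_hom`). This gives well-definedness and injectivity.

Surjectivity is the hard part. A cocycle is continuous only near the identity, so the product
topology on `A × G` need not suit the twisted multiplication. Instead the product neighbourhoods of
the identity are translated around the group. The delicate axiom is continuity of conjugation at the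
identity: the `A`-component of the conjugate of `(0, s)` is a Borel crossed homomorphism up to an
error small near the identity. A Steinhaus argument with Haar measure makes it continuous at the
identity (`tendsto_zero_of_measurable`). -/

theorem measurable_of_countable_cover {X Y ι : Type*} [MeasurableSpace X] [MeasurableSpace Y]
    [Countable ι] {s : ι → Set X} (hs : ∀ i, MeasurableSet (s i)) (hc : ∀ x, ∃ i, x ∈ s i)
    {f : X → Y} (hf : ∀ i, Measurable ((s i).domRestrict f)) : Measurable f := by
  intro t ht
  have h : f ⁻¹' t = ⋃ i, Subtype.val '' ((s i).domRestrict f ⁻¹' t) := by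
    ext x
    simp only [Set.mem_preimage, Set.mem_iUnion, Set.mem_image, Subtype.exists]
    constructor
    · intro hx
      obtain ⟨i, hi⟩ := hc x
      exact ⟨i, x, hi, hx, rfl⟩
    · rintro ⟨i, y, hi, hy, rfl⟩
      exact hy
  rw [h]
  exact MeasurableSet.iUnion fun i => (hs i).subtype_image (hf i ht)

/-- The Lindelöf property of `G`. Demanding `g 0 = 1` makes `U` itself the first translate, so that
a choice by least index is undisturbed near the identity. -/
theorem exists_seq_translates {G : Type*} [Group G] [TopologicalSpace G] [IsTopologicalGroup G]
    [SecondCountableTopology G] {U : Set G} (hU : U ∈ 𝓝 (1 : G)) :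
    ∃ g : ℕ → G, g 0 = 1 ∧ ∀ x, ∃ n, (g n)⁻¹ * x ∈ U := by
  have hn : ∀ x : G, {y | x⁻¹ * y ∈ U} ∈ 𝓝 x := fun x => by
    refine ContinuousAt.preimage_mem_nhds (f := fun y => x⁻¹ * y) (by fun_prop) ?_
    rwa [inv_mul_cancel]
  obtain ⟨s, hs, hc⟩ := TopologicalSpace.countable_cover_nhds hn
  have hne : s.Nonempty := by
    by_contra h
    rw [Set.not_nonempty_iff_eq_empty] at h
    subst h
    have : (1 : G) ∈ (Set.univ : Set G) := trivial
    rw [← hc] at this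
    simp at this
  obtain ⟨g, rfl⟩ := hs.exists_eq_range hne
  refine ⟨fun n => n.casesOn 1 g, rfl, fun x => ?_⟩
  have hx : x ∈ (Set.univ : Set G) := trivial
  rw [← hc] at hx
  simp only [Set.mem_range, Set.iUnion_exists, Set.iUnion_iUnion_eq', Set.mem_iUnion] at hx
  obtain ⟨n, hn⟩ := hx
  exact ⟨n + 1, hn⟩

theorem isLCM_iff {X : Type*} {Y : Type*} [TopologicalSpace X] [One X] [TopologicalSpace Y]
    [MeasurableSpace X] [BorelSpace X] [MeasurableSpace Y] [BorelSpace Y] {f : X → Y} :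
    IsLCM f ↔ Measurable f ∧ ∃ U ∈ 𝓝 (1 : X), ContinuousOn f U := by
  borelize X Y
  rfl

theorem IsLCM.const {X : Type*} {Y : Type*} [TopologicalSpace X] [One X] [TopologicalSpace Y]
    (y : Y) : IsLCM (fun _ : X => y) := by
  borelize X Y
  exact isLCM_iff.2 ⟨measurable_const, Set.univ, Filter.univ_mem, continuousOn_const⟩

theorem IsLCM.continuous_comp {X : Type*} {Y : Type*} {Z : Type*} [TopologicalSpace X] [One X]
    [TopologicalSpace Y] [TopologicalSpace Z] {f : X → Y} {p : Y → Z} (hf : IsLCM f)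
    (hp : Continuous p) : IsLCM (fun x => p (f x)) := by
  borelize X Y Z
  rw [isLCM_iff] at hf ⊢
  obtain ⟨hm, U, hU, hc⟩ := hf
  exact ⟨hp.measurable.comp hm, U, hU, hp.comp_continuousOn hc⟩

theorem IsLCM.mul {X : Type*} {E : Type*} [TopologicalSpace X] [One X] [TopologicalSpace E]
    [SecondCountableTopology E] [Mul E] [ContinuousMul E] {f g : X → E}
    (hf : IsLCM f) (hg : IsLCM g) : IsLCM (fun x => f x * g x) := by
  borelize X E
  rw [isLCM_iff] at hf hg ⊢
  obtain ⟨hm, U, hU, hc⟩ := hf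
  obtain ⟨hm', V, hV, hc'⟩ := hg
  exact ⟨hm.mul hm', U ∩ V, Filter.inter_mem hU hV,
    (hc.mono Set.inter_subset_left).mul (hc'.mono Set.inter_subset_right)⟩

/-- Closed embeddings are measurable embeddings, so regularity of an `A`-valued map can be tested in
`E`, where it is an explicit product of sections. -/
theorem IsLCM.of_isClosedEmbedding {X : Type*} {Y : Type*} {Z : Type*} [TopologicalSpace X] [One X]
    [TopologicalSpace Y] [TopologicalSpace Z] {f : X → Y} {p : Y → Z} (hp : IsClosedEmbedding p)
    (hf : IsLCM (fun x => p (f x))) : IsLCM f := by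
  borelize X Y Z
  rw [isLCM_iff] at hf ⊢
  obtain ⟨hm, U, hU, hc⟩ := hf
  exact ⟨hp.measurableEmbedding.measurable_comp_iff.1 hm, U, hU,
    hp.isInducing.continuousOn_iff.2 hc⟩

/-! ### Low degree cochains -/

section LowDegree

variable {G : Type u} {A : Type v} [Group G] [AddCommGroup A] [DistribMulAction G A]

theorem coboundary_one_apply (f : (Fin 1 → G) → A) (s t : G) :
    coboundary f ![s, t] = s • f ![t] - f ![s * t] + f ![s] := by
  have h0 : Fin.contractNth (0 : Fin 2) (· * ·) ![s, t] = ![s * t] := by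
    funext i; fin_cases i; rfl
  have h1 : Fin.contractNth (1 : Fin 2) (· * ·) ![s, t] = ![s] := by
    funext i; fin_cases i; rfl
  have h2 : (fun i : Fin 1 => ![s, t] i.succ) = ![t] := by
    funext i; fin_cases i; rfl
  change s • f (fun i : Fin 1 => ![s, t] i.succ) +
    ∑ j : Fin 2, (-1 : ℤ) ^ ((j : ℕ) + 1) • f (Fin.contractNth j (· * ·) ![s, t]) = _
  rw [Fin.sum_univ_two, h0, h1, h2]
  simp
  abel

theorem coboundary_two_apply (f : (Fin 2 → G) → A) (r s t : G) :
    coboundary f ![r, s, t] = r • f ![s, t] - f ![r * s, t] + f ![r, s * t] - f ![r, s] := by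
  have h0 : Fin.contractNth (0 : Fin 3) (· * ·) ![r, s, t] = ![r * s, t] := by
    funext i; fin_cases i <;> rfl
  have h1 : Fin.contractNth (1 : Fin 3) (· * ·) ![r, s, t] = ![r, s * t] := by
    funext i; fin_cases i <;> rfl
  have h2 : Fin.contractNth (2 : Fin 3) (· * ·) ![r, s, t] = ![r, s] := by
    funext i; fin_cases i <;> rfl
  have h3 : (fun i : Fin 2 => ![r, s, t] i.succ) = ![s, t] := by
    funext i; fin_cases i <;> rfl
  change r • f (fun i : Fin 2 => ![r, s, t] i.succ) +
    ∑ j : Fin 3, (-1 : ℤ) ^ ((j : ℕ) + 1) • f (Fin.contractNth j (· * ·) ![r, s, t]) = _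
  rw [Fin.sum_univ_three, h0, h1, h2, h3]
  simp [pow_succ]
  abel

end LowDegree

section Classes

variable {G : Type u} {A : Type v} [Group G] [TopologicalSpace G] [IsTopologicalGroup G]
  [SecondCountableTopology G] [AddCommGroup A] [TopologicalSpace A] [IsTopologicalAddGroup A]
  [SecondCountableTopology A] [DistribMulAction G A] [ContinuousSMul G A]

theorem mem_cocycles_two_iff (F : cochains G A 2) : F ∈ cocycles G A 2 ↔
    ∀ r s t : G, r • F.1 ![s, t] + F.1 ![r, s * t] = F.1 ![r * s, t] + F.1 ![r, s] := by
  have h : F ∈ cocycles G A 2 ↔ coboundary F.1 = 0 := by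
    rw [cocycles, AddMonoidHom.mem_ker, Subtype.ext_iff]
    rfl
  rw [h]
  constructor
  · intro h r s t
    have := congrFun h ![r, s, t]
    rw [coboundary_two_apply, Pi.zero_apply] at this
    rw [← sub_eq_zero, ← this]
    abel
  · intro h
    funext x
    have hx : x = ![x 0, x 1, x 2] := by funext i; fin_cases i <;> rfl
    rw [hx, coboundary_two_apply, Pi.zero_apply, ← sub_eq_zero.2 (h (x 0) (x 1) (x 2))]
    abel

theorem mk_eq_mk_iff (F F' : cocycles G A 2) :
    (QuotientAddGroup.mk F : H G A 2) = QuotientAddGroup.mk F' ↔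
      ∃ β : G → A, IsLCM β ∧
        ∀ s t, F'.1.1 ![s, t] = F.1.1 ![s, t] + (s • β t - β (s * t) + β s) := by
  rw [QuotientAddGroup.eq, AddSubgroup.mem_addSubgroupOf]
  constructor
  · rintro ⟨b, hb⟩
    have hb' : IsLCM b.1 := b.2
    refine ⟨fun s => b.1 ![s], hb'.comp (p := fun s => ![s]) (by fun_prop) ?_, fun s t => ?_⟩
    · funext i; fin_cases i; rfl
    · rw [← coboundary_one_apply]
      have := congrFun (congrArg Subtype.val hb) ![s, t]
      change coboundary b.1 ![s, t] = -F.1.1 ![s, t] + F'.1.1 ![s, t] at this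
      rw [this]
      abel
  · rintro ⟨β, hβ, h⟩
    refine ⟨⟨fun x => β (x 0), hβ.comp (p := fun x : Fin 1 → G => x 0) (by fun_prop) rfl⟩,
      Subtype.ext ?_⟩
    funext x
    have hx : x = ![x 0, x 1] := by funext i; fin_cases i <;> rfl
    change coboundary (fun x : Fin 1 → G => β (x 0)) x = -F.1.1 x + F'.1.1 x
    rw [hx, coboundary_one_apply, h]
    simp

end Classes

/-! ### Elementary properties of topological extensions -/

namespace TopExtension

variable {G : Type u} {A : Type v} [Group G] [TopologicalSpace G]
  [AddCommGroup A] [TopologicalSpace A] [DistribMulAction G A] (S : TopExtension G A)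

/-- The inclusion of the additive group `A`. -/
def incl (a : A) : S.E := S.ext.inl (Multiplicative.ofAdd a)

theorem incl_add (a b : A) : S.incl (a + b) = S.incl a * S.incl b := by
  simp [incl]

theorem incl_zero : S.incl 0 = 1 := by
  simp [incl]

theorem incl_injective : Function.Injective S.incl := fun _ _ h =>
  Multiplicative.ofAdd.injective (S.ext.inl_injective h)

@[simp]
theorem rightHom_incl (a : A) : S.ext.rightHom (S.incl a) = 1 :=
  S.ext.rightHom_inl _

theorem mul_incl (e : S.E) (a : A) : e * S.incl a = S.incl (S.ext.rightHom e • a) * e := by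
  rw [← mul_inv_eq_iff_eq_mul]
  exact S.conj_inl e a

theorem exists_incl_eq {e : S.E} (h : S.ext.rightHom e = 1) : ∃ a, S.incl a = e := by
  rw [← MonoidHom.mem_ker, ← S.ext.range_inl_eq_ker_rightHom] at h
  obtain ⟨a, rfl⟩ := h
  exact ⟨a.toAdd, rfl⟩

theorem isClosedEmbedding_incl : IsClosedEmbedding S.incl :=
  .of_continuous_injective_isClosedMap
    (S.continuous_inl.comp continuous_ofAdd) S.incl_injective
    (S.isClosedMap_inl.comp (Homeomorph.isClosedMap
      (Homeomorph.mk (Multiplicative.ofAdd (α := A)) continuous_ofAdd continuous_toAdd)))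

theorem continuous_incl : Continuous S.incl := S.isClosedEmbedding_incl.continuous

end TopExtension

/-! ### Sections of topological extensions -/

namespace TopExtension

section Algebra

variable {G : Type u} {A : Type v} [Group G] [TopologicalSpace G]
  [AddCommGroup A] [TopologicalSpace A] [DistribMulAction G A] {S : TopExtension G A}

theorem isFactorSet_iff {σ : G → S.E} {f : (Fin 2 → G) → A} :
    IsFactorSet S σ f ↔ ∀ s t, S.incl (f ![s, t]) * σ (s * t) = σ s * σ t :=
  forall₂_congr fun s t => by rw [← eq_mul_inv_iff_mul_eq]; rfl

theorem exists_incl_mul_eq {e e' : S.E} (h : S.ext.rightHom e = S.ext.rightHom e') :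
    ∃ a, S.incl a * e = e' := by
  obtain ⟨a, ha⟩ := S.exists_incl_eq (e := e' * e⁻¹) (by rw [map_mul, map_inv, h, mul_inv_cancel])
  exact ⟨a, by rw [ha, inv_mul_cancel_right]⟩

theorem exists_incl_mul_section_eq {σ : G → S.E} (hσ : ∀ s, S.ext.rightHom (σ s) = s) (e : S.E) :
    ∃ a, S.incl a * σ (S.ext.rightHom e) = e :=
  exists_incl_mul_eq (hσ _)

/-- The multiplication of `E` in the coordinates `(a, s)`; the later algebra with sections rests on
it. -/
theorem incl_mul_section_mul {σ : G → S.E} (hσ : ∀ s, S.ext.rightHom (σ s) = s)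
    {f : (Fin 2 → G) → A} (hf : IsFactorSet S σ f) (a b : A) (s t : G) :
    (S.incl a * σ s) * (S.incl b * σ t) = S.incl (a + s • b + f ![s, t]) * σ (s * t) := by
  rw [isFactorSet_iff] at hf
  rw [S.incl_add, mul_assoc _ (S.incl (f _)), hf, S.incl_add, mul_assoc, ← mul_assoc (σ s),
    S.mul_incl, hσ]
  simp only [mul_assoc]

theorem cocycle_of_isFactorSet {σ : G → S.E} (hσ : ∀ s, S.ext.rightHom (σ s) = s)
    {f : (Fin 2 → G) → A} (hf : IsFactorSet S σ f) (r s t : G) :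
    r • f ![s, t] + f ![r, s * t] = f ![r * s, t] + f ![r, s] := by
  have hm := incl_mul_section_mul hσ hf
  have h := mul_assoc (S.incl 0 * σ r) (S.incl 0 * σ s) (S.incl 0 * σ t)
  rw [hm, hm, hm, hm, ← mul_assoc r s t] at h
  have := S.incl_injective (mul_right_cancel h)
  simp only [smul_zero, zero_add, add_zero] at this
  rw [← this, add_comm]

theorem isFactorSet_incl_mul {σ : G → S.E} (hσ : ∀ s, S.ext.rightHom (σ s) = s)
    {f f' : (Fin 2 → G) → A} (hf : IsFactorSet S σ f) {β : G → A}
    (h : ∀ s t, f' ![s, t] = f ![s, t] + (s • β t - β (s * t) + β s)) :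
    IsFactorSet S (fun s => S.incl (β s) * σ s) f' := by
  rw [isFactorSet_iff]
  intro s t
  rw [incl_mul_section_mul hσ hf, ← mul_assoc, ← S.incl_add, h]
  congr 2
  abel

theorem isFactorSet_unique {σ : G → S.E} {f f' : (Fin 2 → G) → A} (hf : IsFactorSet S σ f)
    (hf' : IsFactorSet S σ f') : f = f' := by
  funext x
  have hx : x = ![x 0, x 1] := by funext i; fin_cases i <;> rfl
  rw [hx]
  exact S.incl_injective ((hf _ _).trans (hf' _ _).symm)

end Algebra

variable {G : Type u} {A : Type v} [Group G] [TopologicalSpace G]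
  [AddCommGroup A] [TopologicalSpace A] [DistribMulAction G A] {S : TopExtension G A}

theorem IsLocallySplit.exists_continuousOn (hS : S.IsLocallySplit) :
    ∃ U : Set G, IsOpen U ∧ 1 ∈ U ∧ ∃ σ : G → S.E, ContinuousOn σ U ∧
      ∀ s ∈ U, S.ext.rightHom (σ s) = s := by
  classical
  obtain ⟨U, hU, h1, σ, hσ, hr⟩ := hS
  -- The value `1` off `U` is arbitrary.
  refine ⟨U, hU, h1, fun s => if h : s ∈ U then σ ⟨s, h⟩ else 1, ?_, fun s hs => ?_⟩
  · rw [continuousOn_iff_continuous_domRestrict]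
    convert hσ using 1
    funext s
    simp
  · simp [hs, hr]

/-- A locally split extension has a Borel section which is continuous near the identity. -/
theorem IsLocallySplit.exists_section [IsTopologicalGroup G] [SecondCountableTopology G]
    (hS : S.IsLocallySplit) :
    ∃ σ : G → S.E, IsLCM σ ∧ ∀ s, S.ext.rightHom (σ s) = s := by
  classical
  obtain ⟨U, hU, h1, σ, hσ, hr⟩ := hS.exists_continuousOn
  obtain ⟨g, hg0, hg⟩ := exists_seq_translates (hU.mem_nhds h1)
  choose e he using fun n => S.ext.rightHom_surjective (g n)
  -- The least index of a translate containing `x` cuts `G` into countably many Borel pieces, on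
  -- each of which the section is a translate of `σ`.
  let N : G → ℕ := fun x => Nat.find (hg x)
  have hN : ∀ x, (g (N x))⁻¹ * x ∈ U := fun x => Nat.find_spec (hg x)
  have hc : ∀ n, ContinuousOn (fun x => e n * σ ((g n)⁻¹ * x)) {x | (g n)⁻¹ * x ∈ U} := fun n =>
    continuousOn_const.mul (hσ.comp (by fun_prop) fun x hx => hx)
  borelize G S.E
  refine ⟨fun x => e (N x) * σ ((g (N x))⁻¹ * x), isLCM_iff.2 ⟨?_, U, hU.mem_nhds h1, ?_⟩,
    fun s => ?_⟩
  · have hNm : Measurable N := measurable_find hg fun k =>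
      (hU.preimage (continuous_const_mul (g k)⁻¹)).measurableSet
    refine measurable_of_countable_cover (s := fun n => N ⁻¹' {n})
      (fun n => hNm (measurableSet_singleton n)) (fun x => ⟨N x, rfl⟩) fun n => ?_
    have h2 : ContinuousOn (fun x => e (N x) * σ ((g (N x))⁻¹ * x)) (N ⁻¹' {n}) := by
      refine ((hc n).mono ?_).congr ?_
      · rintro x rfl
        exact hN x
      · rintro x rfl
        rfl
    exact (continuousOn_iff_continuous_domRestrict.1 h2).measurable
  -- On `U` the index is `0`. The lift `e 0` of `g 0 = 1` need not be `1`, but a constant factor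
  -- does not affect continuity.
  · refine ((hc 0).mono fun x hx => ?_).congr fun x hx => ?_
    · simpa [hg0] using hx
    · have : N x = 0 := by
        rw [Nat.find_eq_zero]
        simpa [hg0] using hx
      simp only [this]
  · rw [map_mul, he, hr _ (hN s), mul_inv_cancel_left]

/-- The middle group of a locally split extension of second countable groups is second
countable. -/
theorem IsLocallySplit.secondCountableTopology [IsTopologicalGroup G] [SecondCountableTopology G]
    [SecondCountableTopology A] (hS : S.IsLocallySplit) : SecondCountableTopology S.E := by
  obtain ⟨U, hU, h1, σ, hσ, hr⟩ := hS.exists_continuousOn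
  obtain ⟨g, hg0, hg⟩ := exists_seq_translates (hU.mem_nhds h1)
  choose e he using fun n => S.ext.rightHom_surjective (g n)
  have hπ := S.continuous_rightHom
  let W : Set S.E := S.ext.rightHom ⁻¹' U
  have hWo : IsOpen W := hU.preimage hπ
  -- Over `U` the coordinates embed `W` in `A × U`: `ρ` is continuous with continuous left inverse
  -- `ψ`.
  have hW : SecondCountableTopology W := by
    choose α hα using fun w : W => exists_incl_mul_eq (hr _ w.2)
    have hσW : Continuous fun w : W => σ (S.ext.rightHom w) :=
      hσ.comp_continuous (by fun_prop) fun w => w.2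
    have hαc : Continuous α := by
      rw [S.isClosedEmbedding_incl.continuous_iff]
      have : S.incl ∘ α = fun w : W => (w : S.E) * (σ (S.ext.rightHom w))⁻¹ :=
        funext fun w => eq_mul_inv_iff_mul_eq.2 (hα w)
      rw [this]
      exact continuous_subtype_val.mul hσW.inv
    let ρ : W → A × U := fun w => (α w, ⟨S.ext.rightHom w, w.2⟩)
    let ψ : A × U → S.E := fun p => S.incl p.1 * σ p.2
    have hψ : Continuous ψ :=
      (S.continuous_incl.comp continuous_fst).mul
        (hσ.comp_continuous (continuous_subtype_val.comp continuous_snd) fun p => p.2.2)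
    have hρ : Continuous ρ := hαc.prodMk (by fun_prop)
    have hψρ : ψ ∘ ρ = Subtype.val := funext hα
    exact (IsInducing.of_comp hρ hψ (hψρ ▸ IsInducing.subtypeVal)).secondCountableTopology
  let V : ℕ → Set S.E := fun n => {x | (e n)⁻¹ * x ∈ W}
  have hV : ∀ n, SecondCountableTopology (V n) := fun n => by
    let m : V n → W := fun x => ⟨(e n)⁻¹ * x, x.2⟩
    have hm : IsInducing (Subtype.val ∘ m) :=
      (Homeomorph.mulLeft (e n)⁻¹).isInducing.comp IsInducing.subtypeVal
    exact (IsInducing.of_comp (by fun_prop) continuous_subtype_val hm).secondCountableTopology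
  refine TopologicalSpace.secondCountableTopology_of_countable_cover (U := V)
    (fun n => hWo.preimage (continuous_const_mul _)) (Set.iUnion_eq_univ_iff.2 fun x => ?_)
  obtain ⟨n, hn⟩ := hg (S.ext.rightHom x)
  refine ⟨n, ?_⟩
  change S.ext.rightHom ((e n)⁻¹ * x) ∈ U
  rwa [map_mul, map_inv, he]

theorem exists_factorSet [IsTopologicalGroup G] [SecondCountableTopology G]
    [IsTopologicalAddGroup A] [SecondCountableTopology A] [ContinuousSMul G A]
    (hS : S.IsLocallySplit) {σ : G → S.E} (hσ : IsLCM σ) (hr : ∀ s, S.ext.rightHom (σ s) = s) :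
    ∃ F : cocycles G A 2, IsFactorSet S σ F.1.1 := by
  -- Needed so that products of Borel maps into `S.E` are Borel.
  have := hS.secondCountableTopology
  choose f hf using fun x : Fin 2 → G =>
    exists_incl_mul_eq (S := S) (e := σ (x 0 * x 1)) (e' := σ (x 0) * σ (x 1))
      (by rw [map_mul, hr, hr, hr])
  have hfac : IsFactorSet S σ f := isFactorSet_iff.2 fun s t => hf ![s, t]
  have hf' : IsLCM f := by
    refine .of_isClosedEmbedding S.isClosedEmbedding_incl ?_
    have : (fun x => S.incl (f x)) = fun x => σ (x 0) * σ (x 1) * (σ (x 0 * x 1))⁻¹ :=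
      funext fun x => eq_mul_inv_iff_mul_eq.2 (hf x)
    rw [this]
    refine ((hσ.comp (by fun_prop) rfl).mul (hσ.comp (by fun_prop) rfl)).mul
      (IsLCM.continuous_comp (hσ.comp (p := fun x : Fin 2 → G => x 0 * x 1) ?_ ?_) continuous_inv)
    · fun_prop
    · simp
  exact ⟨⟨⟨f, hf'⟩, (mem_cocycles_two_iff _).2 (cocycle_of_isFactorSet hr hfac)⟩, hfac⟩

/-- Sections with the same factor set induce a continuous homomorphism of extensions. -/
theorem exists_continuous_hom {T : TopExtension G A} {σ : G → S.E} (hσ : IsLCM σ)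
    (hσr : ∀ s, S.ext.rightHom (σ s) = s) {τ : G → T.E} (hτ : IsLCM τ)
    (hτr : ∀ s, T.ext.rightHom (τ s) = s) {f : (Fin 2 → G) → A} (hf : IsFactorSet S σ f)
    (hf' : IsFactorSet T τ f) :
    ∃ φ : S.E →* T.E, Continuous φ ∧ ∀ a s, φ (S.incl a * σ s) = T.incl a * τ s := by
  choose α hα using exists_incl_mul_section_eq hσr
  have hαu : ∀ a s, α (S.incl a * σ s) = a := fun a s => by
    have := hα (S.incl a * σ s)
    rw [map_mul, rightHom_incl, hσr, one_mul] at this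
    exact S.incl_injective (mul_right_cancel this)
  have hφ : ∀ a s, T.incl (α (S.incl a * σ s)) * τ (S.ext.rightHom (S.incl a * σ s)) =
      T.incl a * τ s := fun a s => by
    rw [hαu, map_mul, rightHom_incl, hσr, one_mul]
  let φ : S.E →* T.E := MonoidHom.mk' (fun e => T.incl (α e) * τ (S.ext.rightHom e)) fun x y => by
    rw [← hα x, ← hα y, incl_mul_section_mul hσr hf, hφ, hφ, hφ, incl_mul_section_mul hτr hf']
  -- For a homomorphism continuity at `1` suffices, and near `1` both sections are continuous.
  refine ⟨φ, continuous_of_continuousAt_one φ ?_, hφ⟩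
  obtain ⟨-, U, hU, hσc⟩ := hσ
  obtain ⟨-, V, hV, hτc⟩ := hτ
  have hW : S.ext.rightHom ⁻¹' (U ∩ V) ∈ 𝓝 (1 : S.E) :=
    S.continuous_rightHom.continuousAt.preimage_mem_nhds
      (by rw [map_one]; exact Filter.inter_mem hU hV)
  refine ContinuousOn.continuousAt (s := S.ext.rightHom ⁻¹' (U ∩ V)) ?_ hW
  have hαc : ContinuousOn α (S.ext.rightHom ⁻¹' (U ∩ V)) := by
    rw [S.isClosedEmbedding_incl.isInducing.continuousOn_iff]
    have : S.incl ∘ α = fun w => w * (σ (S.ext.rightHom w))⁻¹ :=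
      funext fun w => eq_mul_inv_iff_mul_eq.2 (hα w)
    rw [this]
    exact continuousOn_id.mul
      (hσc.comp S.continuous_rightHom.continuousOn fun x hx => hx.1).inv
  exact (T.continuous_incl.comp_continuousOn hαc).mul
    (hτc.comp S.continuous_rightHom.continuousOn fun x hx => hx.2)

/-! ### Isomorphism of extensions versus cohomology of factor sets -/

section Classification

variable [IsTopologicalGroup G] [SecondCountableTopology G]
    [IsTopologicalAddGroup A] [SecondCountableTopology A] [ContinuousSMul G A]
    {T : TopExtension G A}

/-- Factor sets of isomorphic extensions are cohomologous. -/
theorem IsIso.mk_eq_mk (h : IsIso S T) (hT : T.IsLocallySplit) {σ : G → S.E} (hσ : IsLCM σ)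
    (hσr : ∀ s, S.ext.rightHom (σ s) = s) {τ : G → T.E} (hτ : IsLCM τ)
    (hτr : ∀ s, T.ext.rightHom (τ s) = s) {F F' : cocycles G A 2} (hF : IsFactorSet S σ F.1.1)
    (hF' : IsFactorSet T τ F'.1.1) :
    (QuotientAddGroup.mk F : H G A 2) = QuotientAddGroup.mk F' := by
  have := hT.secondCountableTopology
  obtain ⟨φ, hφ, -⟩ := h
  have hφi : ∀ a, φ.toMulEquiv (S.incl a) = T.incl a := fun a =>
    congrFun φ.inl_comm (Multiplicative.ofAdd a)
  -- The transported section has the same factor set as `σ`, so two sections of the single extension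
  -- `T` remain to be compared.
  let ρ : G → T.E := fun s => φ.toMulEquiv (σ s)
  have hρr : ∀ s, T.ext.rightHom (ρ s) = s := fun s =>
    (congrFun φ.rightHom_comm (σ s)).trans (hσr s)
  have hρ : IsLCM ρ := hσ.continuous_comp hφ
  have hρF : IsFactorSet T ρ F.1.1 := isFactorSet_iff.2 fun s t => by
    rw [← hφi, ← map_mul, isFactorSet_iff.1 hF, map_mul]
  choose β hβ using fun s => exists_incl_mul_eq (S := T) ((hρr s).trans (hτr s).symm)
  have hβ' : IsLCM β := by
    refine .of_isClosedEmbedding T.isClosedEmbedding_incl ?_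
    have : (fun s => T.incl (β s)) = fun s => τ s * (ρ s)⁻¹ :=
      funext fun s => eq_mul_inv_iff_mul_eq.2 (hβ s)
    rw [this]
    exact hτ.mul (hρ.continuous_comp continuous_inv)
  refine (mk_eq_mk_iff F F').2 ⟨β, hβ', ?_⟩
  have h1 := isFactorSet_incl_mul hρr hρF (β := β)
    (f' := fun x => F.1.1 x + (x 0 • β (x 1) - β (x 0 * x 1) + β (x 0))) fun s t => rfl
  rw [funext hβ] at h1
  intro s t
  rw [isFactorSet_unique hF' h1]
  rfl

/-- Extensions with cohomologous factor sets are isomorphic. -/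
theorem isIso_of_mk_eq_mk (hS : S.IsLocallySplit) {σ : G → S.E} (hσ : IsLCM σ)
    (hσr : ∀ s, S.ext.rightHom (σ s) = s) {τ : G → T.E} (hτ : IsLCM τ)
    (hτr : ∀ s, T.ext.rightHom (τ s) = s) {F F' : cocycles G A 2} (hF : IsFactorSet S σ F.1.1)
    (hF' : IsFactorSet T τ F'.1.1)
    (h : (QuotientAddGroup.mk F : H G A 2) = QuotientAddGroup.mk F') : IsIso S T := by
  have := hS.secondCountableTopology
  obtain ⟨β, hβ, hβF⟩ := (mk_eq_mk_iff F F').1 h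
  -- Correcting `σ` by `β` makes the two factor sets equal.
  have hρF := isFactorSet_incl_mul hσr hF hβF
  set ρ : G → S.E := fun s => S.incl (β s) * σ s with hρdef
  have hρ : IsLCM ρ := (hβ.continuous_comp S.continuous_incl).mul hσ
  have hρr : ∀ s, S.ext.rightHom (ρ s) = s := fun s => by
    rw [map_mul, rightHom_incl, one_mul, hσr]
  obtain ⟨φ, hφc, hφ⟩ := exists_continuous_hom hρ hρr hτ hτr hρF hF'
  obtain ⟨ψ, hψc, hψ⟩ := exists_continuous_hom hτ hτr hρ hρr hF' hρF
  have hψφ : ∀ e, ψ (φ e) = e := fun e => by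
    obtain ⟨a, ha⟩ := exists_incl_mul_section_eq hρr e
    rw [← ha, hφ, hψ]
  have hφψ : ∀ e, φ (ψ e) = e := fun e => by
    obtain ⟨a, ha⟩ := exists_incl_mul_section_eq hτr e
    rw [← ha, hψ, hφ]
  -- Sections are not normalised at `1`, so the value on `A` is found by cancelling `φ (ρ 1) = τ 1`.
  have hφi : ∀ a, φ (S.incl a) = T.incl a := fun a => by
    have h0 := hφ 0 1
    have h1 := hφ a 1
    rw [S.incl_zero, T.incl_zero, one_mul, one_mul] at h0
    rw [map_mul, h0] at h1
    exact mul_right_cancel h1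
  refine ⟨⟨⟨⟨φ, ψ, hψφ, hφψ⟩, map_mul φ⟩, funext fun a => hφi a.toAdd, funext fun e => ?_⟩,
    hφc, hψc⟩
  change T.ext.rightHom (φ e) = S.ext.rightHom e
  obtain ⟨a, ha⟩ := exists_incl_mul_section_eq hρr e
  rw [← ha, hφ, map_mul, map_mul, rightHom_incl, rightHom_incl, hρr, hτr]

end Classification

end TopExtension

/-! ### Automatic continuity -/

open scoped Pointwise in
/-- A Borel map which is a crossed homomorphism up to a locally continuous error is continuous at
the identity. -/
theorem tendsto_zero_of_measurable {G : Type*} {A : Type*} [Group G] [TopologicalSpace G]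
    [IsTopologicalGroup G] [LocallyCompactSpace G] [SecondCountableTopology G] [T2Space G]
    [MeasurableSpace G] [BorelSpace G] [AddCommGroup A] [TopologicalSpace A]
    [IsTopologicalAddGroup A] [SecondCountableTopology A] [MeasurableSpace A] [BorelSpace A]
    [DistribMulAction G A] [ContinuousSMul G A] {h : G → A} (hm : Measurable h) {θ : G → G}
    (hθ : Filter.Tendsto θ (𝓝 1) (𝓝 1)) {c : G × G → A} (hc : Filter.Tendsto c (𝓝 (1, 1)) (𝓝 0))
    (hmul : ∀ s t, h (s * t) = h s + θ s • h t + c (s, t)) : Filter.Tendsto h (𝓝 1) (𝓝 0) := by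
  intro W hW
  -- The shape `u + w - x - y` matches the four small terms of `heq` below.
  obtain ⟨V, hV, hVW⟩ : ∃ V ∈ 𝓝 (0 : A), ∀ u ∈ V, ∀ w ∈ V, ∀ x ∈ V, ∀ y ∈ V,
      u + w - x - y ∈ W := by
    have h1 : (fun p : (A × A) × (A × A) => p.1.1 + p.1.2 - p.2.1 - p.2.2) ⁻¹' W ∈
        𝓝 (((0, 0), (0, 0)) : (A × A) × (A × A)) :=
      ContinuousAt.preimage_mem_nhds (by fun_prop) (by simpa using hW)
    rw [nhds_prod_eq, Filter.mem_prod_same_iff] at h1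
    obtain ⟨t, ht, htW⟩ := h1
    rw [nhds_prod_eq, Filter.mem_prod_same_iff] at ht
    obtain ⟨V, hV, hVt⟩ := ht
    exact ⟨V, hV, fun u hu w hw x hx y hy =>
      htW (Set.mk_mem_prod (hVt (Set.mk_mem_prod hu hw)) (hVt (Set.mk_mem_prod hx hy)))⟩
  obtain ⟨N, hN, V', hV', hNV⟩ : ∃ N ∈ 𝓝 (1 : G), ∃ V' ∈ 𝓝 (0 : A), ∀ k ∈ N, ∀ w ∈ V',
      k • w ∈ V := by
    have h1 : (fun p : G × A => p.1 • p.2) ⁻¹' V ∈ 𝓝 ((1, 0) : G × A) :=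
      ContinuousAt.preimage_mem_nhds (by fun_prop) (by simpa using hV)
    obtain ⟨N, hN, V', hV', hs⟩ := mem_nhds_prod_iff.1 h1
    exact ⟨N, hN, V', hV', fun k hk w hw => hs (Set.mk_mem_prod hk hw)⟩
  obtain ⟨W₀, hW₀V, hW₀o, h0W₀⟩ := mem_nhds_iff.1 (Filter.inter_mem hV hV')
  obtain ⟨K₀, hK₀, hcK⟩ : ∃ K₀ ∈ 𝓝 (1 : G), ∀ s ∈ K₀, ∀ t ∈ K₀, c (s, t) ∈ V := by
    have h1 := hc hV
    rw [Filter.mem_map, nhds_prod_eq, Filter.mem_prod_same_iff] at h1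
    obtain ⟨K₀, hK₀, hs⟩ := h1
    exact ⟨K₀, hK₀, fun s hs' t ht => hs (Set.mk_mem_prod hs' ht)⟩
  let μ : MeasureTheory.Measure G := MeasureTheory.Measure.haar
  obtain ⟨O, h1O, hO, hμO⟩ := μ.exists_isOpen_measure_lt_top 1
  obtain ⟨K, hKO, hK, h1K⟩ := mem_nhds_iff.1 (Filter.inter_mem hK₀ (hO.mem_nhds h1O))
  have hcov : ∀ a : A, {x | -a + x ∈ W₀} ∈ 𝓝 a := fun a =>
    ContinuousAt.preimage_mem_nhds (by fun_prop) (by simpa using hW₀o.mem_nhds h0W₀)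
  obtain ⟨s, hs, hsA⟩ := TopologicalSpace.countable_cover_nhds hcov
  -- Countably many translates of `W₀` cover `A`, and `K` has positive measure, so `h` stays near
  -- one value `a` on a non-null part of `K`.
  obtain ⟨a, ha⟩ : ∃ a, μ (K ∩ h ⁻¹' {x | -a + x ∈ W₀}) ≠ 0 := by
    by_contra hcon
    push Not at hcon
    have h1 : μ (⋃ a ∈ s, K ∩ h ⁻¹' {x | -a + x ∈ W₀}) = 0 :=
      (MeasureTheory.measure_biUnion_null_iff hs).2 fun a _ => hcon a
    refine (hK.measure_pos μ ⟨1, h1K⟩).ne' (MeasureTheory.measure_mono_null (fun x hx => ?_) h1)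
    have h2 : h x ∈ (Set.univ : Set A) := trivial
    rw [← hsA] at h2
    simp only [Set.mem_iUnion] at h2 ⊢
    obtain ⟨a, ha, hxa⟩ := h2
    exact ⟨a, ha, hx, hxa⟩
  set S : Set G := K ∩ h ⁻¹' {x | -a + x ∈ W₀} with hS
  have hSm : MeasurableSet S :=
    hK.measurableSet.inter (hm (hW₀o.preimage (continuous_const_add (-a))).measurableSet)
  -- Steinhaus: every `k` near `1` is a quotient `x / y` with `h x` and `h y` both close to `a`.
  have hdiv : S / S ∈ 𝓝 (1 : G) :=
    MeasureTheory.Measure.div_mem_nhds_one_of_haar_pos_ne_top μ S hSm (pos_iff_ne_zero.2 ha)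
      (ne_top_of_le_ne_top hμO.ne (MeasureTheory.measure_mono fun x hx => (hKO hx.1).2))
  have hθa : {k : G | a - θ k • a ∈ V} ∈ 𝓝 1 := by
    have h1 : Filter.Tendsto (fun k => a - θ k • a) (𝓝 1) (𝓝 (a - (1 : G) • a)) :=
      tendsto_const_nhds.sub (hθ.smul_const a)
    rw [one_smul, sub_self] at h1
    exact h1 hV
  rw [Filter.mem_map]
  filter_upwards [hdiv, hK.mem_nhds h1K, hθ hN, hθa] with k hk hkK hkN hka
  obtain ⟨x, hx, y, hy, rfl⟩ := Set.mem_div.1 hk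
  have hxy := hmul (x / y) y
  rw [div_mul_cancel] at hxy
  -- The crossed homomorphism law solved for `h (x / y)`, with the base value `a` subtracted from `h
  -- x` and `h y`; what remains of it is `a - θ k • a`, small because `θ k` tends to `1`.
  have heq : h (x / y) = (a - θ (x / y) • a) + (-a + h x) - θ (x / y) • (-a + h y) -
      c (x / y, y) := by
    rw [hxy, smul_add, smul_neg]
    abel
  rw [Set.mem_preimage, heq]
  exact hVW _ hka _ (hW₀V hx.2).1 _ (hNV _ hkN _ (hW₀V hy.2).2) _
    (hcK _ (hKO hkK).1 _ (hKO hy.1).1)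

/-! ### The extension defined by a normalised cocycle -/

/-- A 2-cocycle `f`, Borel and continuous near the identity, with `f(1, 1) = 0`. -/
structure NormalizedCocycle (G : Type u) (A : Type v) [Group G] [TopologicalSpace G]
    [AddCommGroup A] [TopologicalSpace A] [DistribMulAction G A] where
  /-- The underlying function. -/
  toFun : G → G → A
  isLCM : IsLCM (fun p : G × G => toFun p.1 p.2)
  cocycle : ∀ r s t, r • toFun s t + toFun r (s * t) = toFun (r * s) t + toFun r s
  map_one_one : toFun 1 1 = 0

namespace NormalizedCocycle

section Algebra

variable {G : Type u} {A : Type v} [Group G] [TopologicalSpace G]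
  [AddCommGroup A] [TopologicalSpace A] [DistribMulAction G A]

instance : CoeFun (NormalizedCocycle G A) (fun _ => G → G → A) := ⟨toFun⟩

variable (f : NormalizedCocycle G A)

@[simp]
theorem map_one_left (t : G) : f 1 t = 0 := by
  have := f.cocycle 1 1 t
  rw [f.map_one_one, one_smul, one_mul, one_mul, add_zero] at this
  exact add_eq_left.1 this

@[simp]
theorem map_one_right (r : G) : f r 1 = 0 := by
  have := f.cocycle r 1 1
  rw [f.map_one_one, smul_zero, zero_add, one_mul, mul_one] at this
  exact left_eq_add.1 this

/-- The set `A × G`, to be given the multiplication twisted by the cocycle `f`. -/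
@[ext]
structure Twisted (f : NormalizedCocycle G A) where
  /-- The component in `A`. -/
  fst : A
  /-- The component in `G`. -/
  snd : G

namespace Twisted

variable {f}

instance : Mul (Twisted f) := ⟨fun x y => ⟨x.fst + x.snd • y.fst + f x.snd y.snd, x.snd * y.snd⟩⟩
instance : One (Twisted f) := ⟨⟨0, 1⟩⟩
instance : Inv (Twisted f) := ⟨fun x => ⟨-(x.snd⁻¹ • x.fst) - f x.snd⁻¹ x.snd, x.snd⁻¹⟩⟩

@[simp] theorem mul_fst (x y : Twisted f) :
    (x * y).fst = x.fst + x.snd • y.fst + f x.snd y.snd := rfl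
@[simp] theorem mul_snd (x y : Twisted f) : (x * y).snd = x.snd * y.snd := rfl
@[simp] theorem one_fst : (1 : Twisted f).fst = 0 := rfl
@[simp] theorem one_snd : (1 : Twisted f).snd = 1 := rfl
@[simp] theorem inv_fst (x : Twisted f) :
    x⁻¹.fst = -(x.snd⁻¹ • x.fst) - f x.snd⁻¹ x.snd := rfl
@[simp] theorem inv_snd (x : Twisted f) : x⁻¹.snd = x.snd⁻¹ := rfl

/-- Associativity is the cocycle identity, and the normalisation makes `⟨0, 1⟩` the unit. -/
instance : Group (Twisted f) :=
  Group.ofLeftAxioms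
    (fun x y z => by
      refine Twisted.ext ?_ (mul_assoc _ _ _)
      have := f.cocycle x.snd y.snd z.snd
      simp only [mul_fst, mul_snd, smul_add, mul_smul]
      rw [← sub_eq_zero] at this ⊢
      rw [← neg_eq_zero, ← this]
      abel)
    (fun x => by ext <;> simp)
    (fun x => by ext <;> simp [sub_add_eq_add_sub])

variable (f) in
/-- The inclusion of `A`. -/
def inl : Multiplicative A →* Twisted f where
  toFun a := ⟨a.toAdd, 1⟩
  map_one' := rfl
  map_mul' a b := by ext <;> simp

variable (f) in
/-- The projection to `G`. -/
def rightHom : Twisted f →* G where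
  toFun := snd
  map_one' := rfl
  map_mul' _ _ := rfl

variable (f) in
/-- The underlying extension of abstract groups. -/
def groupExtension : GroupExtension (Multiplicative A) (Twisted f) G where
  inl := inl f
  rightHom := rightHom f
  inl_injective a b h := congrArg Twisted.fst h
  range_inl_eq_ker_rightHom := by
    ext x
    constructor
    · rintro ⟨a, rfl⟩
      rfl
    · intro h
      exact ⟨Multiplicative.ofAdd x.fst, Twisted.ext rfl h.symm⟩
  rightHom_surjective s := ⟨⟨0, s⟩, rfl⟩

theorem conj_inl (x : Twisted f) (a : A) : x * inl f (Multiplicative.ofAdd a) * x⁻¹ =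
    inl f (Multiplicative.ofAdd (x.snd • a)) := by
  rw [mul_inv_eq_iff_eq_mul]
  ext <;> simp [inl, add_comm]

/-- Since `⟨a, s⟩` is `inl f a` times `⟨0, s⟩`, continuity of conjugation reduces to a function of
`s` alone. -/
theorem conj_mk (x : Twisted f) (a : A) (s : G) : x * ⟨a, s⟩ * x⁻¹ =
    ⟨x.snd • a + (x * ⟨0, s⟩ * x⁻¹).fst, x.snd * s * x.snd⁻¹⟩ := by
  have h1 : (⟨a, s⟩ : Twisted f) = inl f (Multiplicative.ofAdd a) * ⟨0, s⟩ := by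
    ext <;> simp [inl]
  have h2 : x * ⟨a, s⟩ * x⁻¹ =
      (x * inl f (Multiplicative.ofAdd a) * x⁻¹) * (x * ⟨0, s⟩ * x⁻¹) := by
    rw [h1]; group
  rw [h2, conj_inl]
  generalize hy : x * (⟨0, s⟩ : Twisted f) * x⁻¹ = y
  have hs : y.snd = x.snd * s * x.snd⁻¹ := by rw [← hy]; rfl
  rw [← hs]
  ext <;> simp [inl]

/-- Conjugate `⟨0, s⟩ * ⟨0, t⟩ = ⟨f s t, s * t⟩`. The result is the hypothesis `hmul` of
`tendsto_zero_of_measurable`. -/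
theorem conj_mul_fst (x : Twisted f) (s t : G) : (x * ⟨0, s * t⟩ * x⁻¹).fst =
    (x * ⟨0, s⟩ * x⁻¹).fst + (x.snd * s * x.snd⁻¹) • (x * ⟨0, t⟩ * x⁻¹).fst +
      (f (x.snd * s * x.snd⁻¹) (x.snd * t * x.snd⁻¹) - x.snd • f s t) := by
  have h1 : (⟨0, s⟩ : Twisted f) * ⟨0, t⟩ = ⟨f s t, s * t⟩ := by ext <;> simp
  have h2 : x * ⟨f s t, s * t⟩ * x⁻¹ = (x * ⟨0, s⟩ * x⁻¹) * (x * ⟨0, t⟩ * x⁻¹) := by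
    rw [← h1]; group
  rw [conj_mk] at h2
  have h3 := congrArg fst h2
  rw [mul_fst] at h3
  change x.snd • f s t + (x * ⟨0, s * t⟩ * x⁻¹).fst =
    (x * ⟨0, s⟩ * x⁻¹).fst + (x.snd * s * x.snd⁻¹) • (x * ⟨0, t⟩ * x⁻¹).fst +
      f (x.snd * s * x.snd⁻¹) (x.snd * t * x.snd⁻¹) at h3
  rw [← add_sub_assoc, ← h3, add_sub_cancel_left]

end Twisted

end Algebra

end NormalizedCocycle

/-! ### The topology of the twisted product and its canonical section -/

namespace NormalizedCocycle

variable {G : Type u} {A : Type v} [Group G] [TopologicalSpace G]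
  [AddCommGroup A] [TopologicalSpace A] [DistribMulAction G A] {f : NormalizedCocycle G A}

theorem tendsto_nhds_one (f : NormalizedCocycle G A) {X : Type*} {l : Filter X} {p q : X → G}
    (hp : Filter.Tendsto p l (𝓝 1)) (hq : Filter.Tendsto q l (𝓝 1)) :
    Filter.Tendsto (fun x => f (p x) (q x)) l (𝓝 0) := by
  obtain ⟨-, U, hU, hc⟩ := f.isLCM
  have h := (hc.continuousAt hU).tendsto
  rw [Prod.fst_one, Prod.snd_one, f.map_one_one] at h
  refine h.comp (f := fun x => (p x, q x)) ?_
  rw [Prod.one_eq_mk, nhds_prod_eq]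
  exact hp.prodMk hq

namespace Twisted

variable (f) in
/-- The filter of neighbourhoods of the identity: it is that of the product topology. -/
def nhdsOne : Filter (Twisted f) := (𝓝 0).comap fst ⊓ (𝓝 1).comap snd

theorem tendsto_nhdsOne_iff {X : Type*} {l : Filter X} {p : X → Twisted f} :
    Filter.Tendsto p l (nhdsOne f) ↔ Filter.Tendsto (fun x => (p x).fst) l (𝓝 0) ∧
      Filter.Tendsto (fun x => (p x).snd) l (𝓝 1) := by
  rw [nhdsOne, Filter.tendsto_inf, Filter.tendsto_comap_iff, Filter.tendsto_comap_iff]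
  rfl

theorem tendsto_fst : Filter.Tendsto (fst (f := f)) (nhdsOne f) (𝓝 0) :=
  (tendsto_nhdsOne_iff.1 Filter.tendsto_id).1

theorem tendsto_snd : Filter.Tendsto (snd (f := f)) (nhdsOne f) (𝓝 1) :=
  (tendsto_nhdsOne_iff.1 Filter.tendsto_id).2

variable [IsTopologicalGroup G] [IsTopologicalAddGroup A] [ContinuousSMul G A]

theorem tendsto_mul : Filter.Tendsto (fun p : Twisted f × Twisted f => p.1 * p.2)
    (nhdsOne f ×ˢ nhdsOne f) (nhdsOne f) := by
  have h1 : Filter.Tendsto (Prod.fst : Twisted f × Twisted f → _) (nhdsOne f ×ˢ nhdsOne f)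
      (nhdsOne f) := Filter.tendsto_fst
  have h2 : Filter.Tendsto (Prod.snd : Twisted f × Twisted f → _) (nhdsOne f ×ˢ nhdsOne f)
      (nhdsOne f) := Filter.tendsto_snd
  rw [tendsto_nhdsOne_iff] at h1 h2
  refine tendsto_nhdsOne_iff.2 ⟨?_, by simpa using h1.2.mul h2.2⟩
  simpa using (h1.1.add (h1.2.smul h2.1)).add (f.tendsto_nhds_one h1.2 h2.2)

theorem tendsto_inv : Filter.Tendsto (fun x : Twisted f => x⁻¹) (nhdsOne f) (nhdsOne f) := by
  have h1 : Filter.Tendsto (fun x : Twisted f => x.snd⁻¹) (nhdsOne f) (𝓝 1) := by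
    simpa using (tendsto_snd (f := f)).inv
  refine tendsto_nhdsOne_iff.2 ⟨?_, h1⟩
  have := ((h1.smul (tendsto_fst (f := f))).neg).sub (f.tendsto_nhds_one h1 tendsto_snd)
  simpa using this

variable [LocallyCompactSpace G] [SecondCountableTopology G] [T2Space G]
  [SecondCountableTopology A]

/-- The first component of the conjugate of `(0, s)` is continuous in `s` at the identity. -/
theorem tendsto_conj_fst (x : Twisted f) :
    Filter.Tendsto (fun s : G => (x * ⟨0, s⟩ * x⁻¹).fst) (𝓝 1) (𝓝 0) := by
  borelize G A
  have hθ : Filter.Tendsto (fun s : G => x.snd * s * x.snd⁻¹) (𝓝 1) (𝓝 1) := by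
    have : Continuous fun s : G => x.snd * s * x.snd⁻¹ := by fun_prop
    simpa using this.tendsto 1
  -- By second countability the Borel σ-algebra of `G × G` is the product one, so restrictions of
  -- `f` to slices are Borel.
  have hf : Measurable fun p : G × G => f p.1 p.2 := (isLCM_iff.1 f.isLCM).1
  refine tendsto_zero_of_measurable (θ := fun s => x.snd * s * x.snd⁻¹)
    (c := fun p => f (x.snd * p.1 * x.snd⁻¹) (x.snd * p.2 * x.snd⁻¹) - x.snd • f p.1 p.2) ?_ hθ ?_
    (conj_mul_fst x)
  · have h1 : Measurable fun s : G => f x.snd s := hf.comp measurable_prodMk_left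
    have h2 : Measurable fun s : G => f (x.snd * s) x.snd⁻¹ :=
      hf.comp (f := fun s => (x.snd * s, x.snd⁻¹)) (by fun_prop)
    have h3 : Measurable fun s : G => (x.snd * s) • x⁻¹.fst :=
      Continuous.measurable (by fun_prop)
    change Measurable fun s : G => x.fst + x.snd • (0 : A) + f x.snd s + (x.snd * s) • x⁻¹.fst +
      f (x.snd * s) x.snd⁻¹
    exact ((measurable_const.add h1).add h3).add h2
  · rw [nhds_prod_eq]
    have h1 : Filter.Tendsto (Prod.fst : G × G → G) (𝓝 1 ×ˢ 𝓝 1) (𝓝 1) := Filter.tendsto_fst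
    have h2 : Filter.Tendsto (Prod.snd : G × G → G) (𝓝 1 ×ˢ 𝓝 1) (𝓝 1) := Filter.tendsto_snd
    have := (f.tendsto_nhds_one (hθ.comp h1) (hθ.comp h2)).sub
      ((f.tendsto_nhds_one h1 h2).const_smul x.snd)
    simpa using this

theorem tendsto_conj (x : Twisted f) :
    Filter.Tendsto (fun y => x * y * x⁻¹) (nhdsOne f) (nhdsOne f) := by
  have hc : (fun y : Twisted f => x * y * x⁻¹) = fun y =>
      ⟨x.snd • y.fst + (x * ⟨0, y.snd⟩ * x⁻¹).fst, x.snd * y.snd * x.snd⁻¹⟩ :=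
    funext fun y => conj_mk x y.fst y.snd
  rw [hc]
  refine tendsto_nhdsOne_iff.2 ⟨?_, ?_⟩
  · have := ((tendsto_fst (f := f)).const_smul x.snd).add
      ((tendsto_conj_fst x).comp tendsto_snd)
    simpa using! this
  · have h1 : Continuous fun s : G => x.snd * s * x.snd⁻¹ := by fun_prop
    have h2 := h1.tendsto 1
    rw [mul_one, mul_inv_cancel] at h2
    exact h2.comp tendsto_snd

variable (f) in
/-- The neighbourhoods of the identity as a group filter basis. -/
abbrev groupFilterBasis : GroupFilterBasis (Twisted f) where
  sets := (nhdsOne f).sets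
  nonempty := ⟨_, Filter.univ_mem⟩
  inter_sets hx hy := ⟨_, Filter.inter_mem hx hy, subset_rfl⟩
  one' {U} hU := by
    have : Filter.Tendsto (fun _ : Unit => (1 : Twisted f)) (pure ()) (nhdsOne f) :=
      tendsto_nhdsOne_iff.2 ⟨tendsto_const_nhds, tendsto_const_nhds⟩
    exact this hU
  mul' {U} hU := by
    obtain ⟨V, hV, hVU⟩ := Filter.mem_prod_same_iff.1 (tendsto_mul hU)
    exact ⟨V, hV, Set.mul_subset_iff.2 fun x hx y hy => hVU (Set.mk_mem_prod hx hy)⟩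
  inv' hU := ⟨_, tendsto_inv hU, subset_rfl⟩
  conj' x {U} hU := ⟨_, tendsto_conj x hU, subset_rfl⟩

instance : TopologicalSpace (Twisted f) := (groupFilterBasis f).topology

instance : IsTopologicalGroup (Twisted f) := (groupFilterBasis f).isTopologicalGroup

theorem nhds_one_eq : 𝓝 (1 : Twisted f) = nhdsOne f := by
  refine (groupFilterBasis f).nhds_one_eq.trans (Filter.ext fun s => ?_)
  rw [FilterBasis.mem_filter_iff]
  exact ⟨fun ⟨t, ht, hts⟩ => Filter.mem_of_superset ht hts, fun hs => ⟨s, hs, subset_rfl⟩⟩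

theorem isInducing_inl : IsInducing (inl f) := by
  rw [IsTopologicalGroup.isInducing_iff_nhds_one, nhds_one_eq, nhdsOne, Filter.comap_inf,
    Filter.comap_comap, Filter.comap_comap]
  have h : (snd ∘ inl f) = fun _ => (1 : G) := rfl
  rw [h, Filter.comap_const_of_mem (fun s hs => mem_of_mem_nhds hs), inf_top_eq]
  exact Filter.comap_id.symm

theorem continuous_rightHom : Continuous (rightHom f) :=
  continuous_of_tendsto_nhds_one _ <| by
    rw [nhds_one_eq]
    exact tendsto_snd

theorem isClosedEmbedding_inl : IsClosedEmbedding (inl f) := by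
  refine ⟨⟨isInducing_inl, (groupExtension f).inl_injective⟩, ?_⟩
  -- The image is the fibre over `1`, closed because points of `G` are closed.
  have h : Set.range (inl f) = rightHom f ⁻¹' {1} := by
    have := congrArg (SetLike.coe) (groupExtension f).range_inl_eq_ker_rightHom
    exact this
  rw [h]
  exact isClosed_singleton.preimage continuous_rightHom

/-- Openness at `1` follows from the section `s ↦ ⟨0, s⟩`, which is continuous there. -/
theorem isOpenMap_rightHom : IsOpenMap (rightHom f) := by
  rw [IsTopologicalGroup.isOpenMap_iff_nhds_one, nhds_one_eq]
  have h : Filter.Tendsto (fun s => (⟨0, s⟩ : Twisted f)) (𝓝 1) (nhdsOne f) :=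
    tendsto_nhdsOne_iff.2 ⟨tendsto_const_nhds, Filter.tendsto_id⟩
  have h2 := Filter.map_mono (m := rightHom f) h
  rw [Filter.map_map] at h2
  exact h2

variable (f) in
/-- The topological extension defined by a normalised cocycle. -/
def extension : TopExtension G A where
  E := Twisted f
  ext := groupExtension f
  continuous_inl := isClosedEmbedding_inl.continuous
  isClosedMap_inl := isClosedEmbedding_inl.isClosedMap
  continuous_rightHom := continuous_rightHom
  isOpenMap_rightHom := isOpenMap_rightHom
  conj_inl := conj_inl

/-- Writing `⟨0, t⟩` as `⟨0, s⟩` times an element near `1` reduces continuity at `s` to that of `f`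
at `(s, 1)`, where `f` vanishes. Hence `U` is the slice of the continuity domain of `f` at second
coordinate `1`. -/
theorem exists_continuousOn : ∃ U : Set G, IsOpen U ∧ 1 ∈ U ∧
    ContinuousOn (fun s => (⟨0, s⟩ : Twisted f)) U := by
  obtain ⟨-, Ω, hΩ, hc⟩ := f.isLCM
  obtain ⟨Ω', hΩ', hΩo, h1⟩ := mem_nhds_iff.1 hΩ
  refine ⟨{s | (s, 1) ∈ Ω'}, hΩo.preimage (by fun_prop), h1, fun s hs => ?_⟩
  refine ContinuousAt.continuousWithinAt ?_
  have h2 : (fun t => (⟨0, t⟩ : Twisted f)) =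
      fun t => ⟨0, s⟩ * ⟨-(s⁻¹ • f s (s⁻¹ * t)), s⁻¹ * t⟩ := by
    funext t
    ext <;> simp
  have h3 : Filter.Tendsto (fun t => s⁻¹ * t) (𝓝 s) (𝓝 1) := by
    simpa using (continuous_const_mul s⁻¹).tendsto s
  have h4 : Filter.Tendsto (fun t => f s (s⁻¹ * t)) (𝓝 s) (𝓝 0) := by
    have h5 := (hc.continuousAt (Filter.mem_of_superset (hΩo.mem_nhds hs) hΩ')).tendsto
    rw [f.map_one_right] at h5
    refine h5.comp (f := fun t => (s, s⁻¹ * t)) ?_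
    rw [nhds_prod_eq]
    exact tendsto_const_nhds.prodMk h3
  have h6 : Filter.Tendsto (fun t => (⟨-(s⁻¹ • f s (s⁻¹ * t)), s⁻¹ * t⟩ : Twisted f)) (𝓝 s)
      (𝓝 1) := by
    rw [nhds_one_eq]
    exact tendsto_nhdsOne_iff.2 ⟨by simpa using (h4.const_smul s⁻¹).neg, h3⟩
  rw [ContinuousAt, h2]
  simpa using h6.const_mul (⟨0, s⟩ : Twisted f)

theorem isLCM_section : IsLCM (fun s => (⟨0, s⟩ : Twisted f)) := by
  obtain ⟨U, hU, h1, hc⟩ := exists_continuousOn (f := f)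
  borelize G A (Twisted f)
  refine isLCM_iff.2 ⟨?_, U, hU.mem_nhds h1, hc⟩
  obtain ⟨g, -, hg⟩ := exists_seq_translates (hU.mem_nhds h1)
  refine measurable_of_countable_cover (s := fun n => {x | (g n)⁻¹ * x ∈ U})
    (fun n => (hU.preimage (continuous_const_mul _)).measurableSet) hg fun n => ?_
  have hf : Measurable fun p : G × G => f p.1 p.2 := (isLCM_iff.1 f.isLCM).1
  -- On each translate the section is a Borel map to `A × U` followed by the continuous `ψ`; the
  -- term `-f` cancels the cocycle created by `⟨0, g n⟩ * ⟨0, (g n)⁻¹ * x⟩`.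
  let ρ : {x | (g n)⁻¹ * x ∈ U} → A × U := fun x => (-f (g n) ((g n)⁻¹ * x), ⟨(g n)⁻¹ * x, x.2⟩)
  have hρ : Measurable ρ := by
    refine Measurable.prodMk (hf.comp (f := fun x => (g n, (g n)⁻¹ * x)) ?_
      |>.comp measurable_subtype_coe).neg (Continuous.measurable (by fun_prop))
    fun_prop
  let ψ : A × U → Twisted f := fun p => inl f (Multiplicative.ofAdd p.1) * ⟨0, g n⟩ * ⟨0, p.2⟩
  have hψ : Continuous ψ := by
    have h2 : Continuous fun p : A × U => inl f (Multiplicative.ofAdd p.1) :=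
      isClosedEmbedding_inl.continuous.comp (continuous_ofAdd.comp continuous_fst)
    exact (h2.mul continuous_const).mul
      (hc.comp_continuous (continuous_subtype_val.comp continuous_snd) fun p => p.2.2)
  have : Set.domRestrict {x | (g n)⁻¹ * x ∈ U} (fun s => (⟨0, s⟩ : Twisted f)) = ψ ∘ ρ := by
    funext x
    ext <;> simp [ψ, ρ, inl]
  rw [this]
  exact hψ.measurable.comp hρ

theorem isLocallySplit : (extension f).IsLocallySplit := by
  obtain ⟨U, hU, h1, hc⟩ := exists_continuousOn (f := f)
  exact ⟨U, hU, h1, _, continuousOn_iff_continuous_domRestrict.1 hc, fun s => rfl⟩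

end Twisted

end NormalizedCocycle

/-! ### Realising every cohomology class -/

section Bijection

variable {G : Type u} {A : Type v} [Group G] [TopologicalSpace G] [IsTopologicalGroup G]
  [LocallyCompactSpace G] [SecondCountableTopology G] [T2Space G]
  [AddCommGroup A] [TopologicalSpace A] [IsTopologicalAddGroup A] [SecondCountableTopology A]
  [DistribMulAction G A] [ContinuousSMul G A]

/-- Every class in `H²` is represented by a factor set of a locally split extension. -/
theorem exists_extension_of_cocycle (F : cocycles G A 2) :
    ∃ (S : LocallySplitExtension G A) (σ : G → S.1.E) (F' : cocycles G A 2), IsLCM σ ∧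
      (∀ s, S.1.ext.rightHom (σ s) = s) ∧ IsFactorSet S.1 σ F'.1.1 ∧
      (QuotientAddGroup.mk F' : H G A 2) = QuotientAddGroup.mk F := by
  have hF : IsLCM F.1.1 := F.1.2
  have hF' : IsLCM (fun p : G × G => F.1.1 ![p.1, p.2]) :=
    hF.comp (p := fun p : G × G => ![p.1, p.2]) (by fun_prop) (by
      funext i; fin_cases i <;> rfl)
  have hcoc := (mem_cocycles_two_iff F.1).1 F.2
  -- The coboundary of the constant cochain `a` is `(s, t) ↦ s • a`; subtracting it normalises the
  -- cocycle within its class.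
  let a : A := F.1.1 ![1, 1]
  let f : NormalizedCocycle G A :=
    { toFun := fun s t => F.1.1 ![s, t] - s • a
      isLCM := by
        have h := hF'.add (IsLCM.smul (p := Prod.fst) continuous_fst (IsLCM.const a)).neg
        convert h using 2
        exact sub_eq_add_neg _ _
      cocycle := fun r s t => by
        have := hcoc r s t
        simp only [smul_sub, mul_smul]
        rw [sub_add_sub_comm, this, sub_add_sub_comm]
      map_one_one := by simp [a] }
  let S : LocallySplitExtension G A :=
    ⟨NormalizedCocycle.Twisted.extension f, NormalizedCocycle.Twisted.isLocallySplit⟩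
  let σ : G → S.1.E := fun s => (⟨0, s⟩ : NormalizedCocycle.Twisted f)
  have hσ : IsLCM σ := NormalizedCocycle.Twisted.isLCM_section
  have hσr : ∀ s, S.1.ext.rightHom (σ s) = s := fun s => rfl
  have hfac : IsFactorSet S.1 σ (fun x => f (x 0) (x 1)) := by
    rw [TopExtension.isFactorSet_iff]
    intro s t
    refine NormalizedCocycle.Twisted.ext ?_ ?_
    · change f s t + (1 : G) • (0 : A) + f 1 (s * t) = 0 + s • (0 : A) + f s t
      simp
    · exact one_mul _
  obtain ⟨F', hfac'⟩ := TopExtension.exists_factorSet S.2 hσ hσr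
  refine ⟨S, σ, F', hσ, hσr, hfac', (mk_eq_mk_iff F' F).2 ⟨fun _ => a, IsLCM.const a, ?_⟩⟩
  intro s t
  rw [TopExtension.isFactorSet_unique hfac' hfac]
  change F.1.1 ![s, t] = F.1.1 ![s, t] - s • a + (s • a - a + a)
  abel

end Bijection

end LocallyContinuousCohomology

/-! ### The classification theorem -/

open LocallyContinuousCohomology in
theorem mainTheorem1 (G : Type u) (A : Type v)
    [Group G] [TopologicalSpace G] [IsTopologicalGroup G]
    [LocallyCompactSpace G] [SecondCountableTopology G] [T2Space G]
    [AddCommGroup A] [TopologicalSpace A] [IsTopologicalAddGroup A]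
    [LocallyCompactSpace A] [SecondCountableTopology A] [T2Space A]
    [DistribMulAction G A] [ContinuousSMul G A] :
    ∃ Φ : ExtensionClasses G A ≃ H G A 2,
      ∀ S : LocallySplitExtension G A,
        -- there is a measurable section that is continuous near the identity
        (∃ σ : G → S.1.E, IsLCM σ ∧ ∀ s, S.1.ext.rightHom (σ s) = s) ∧
        -- and the factor set of any such section is a cocycle representing `Φ [S]`
        ∀ σ : G → S.1.E, IsLCM σ → (∀ s, S.1.ext.rightHom (σ s) = s) →
          ∃ F : cocycles G A 2, IsFactorSet S.1 σ F.1.1 ∧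
            Φ (Quotient.mk _ S) = QuotientAddGroup.mk F := by
  choose σ hσ hσr using fun S : LocallySplitExtension G A => S.2.exists_section
  choose F hF using fun S : LocallySplitExtension G A =>
    TopExtension.exists_factorSet S.2 (hσ S) (hσr S)
  let φ : ExtensionClasses G A → H G A 2 :=
    Quotient.lift (fun S => QuotientAddGroup.mk (F S)) fun S T h =>
      TopExtension.IsIso.mk_eq_mk h T.2 (hσ S) (hσr S) (hσ T) (hσr T) (hF S) (hF T)
  have hφ : Function.Bijective φ := by
    constructor
    · rintro ⟨S⟩ ⟨T⟩ h
      exact Quotient.sound (TopExtension.isIso_of_mk_eq_mk S.2 (hσ S) (hσr S) (hσ T) (hσr T)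
        (hF S) (hF T) h)
    · intro x
      obtain ⟨c, rfl⟩ := QuotientAddGroup.mk_surjective x
      obtain ⟨S, τ, F', hτ, hτr, hF', hc⟩ := exists_extension_of_cocycle c
      -- Independence of the section is the case of the identity isomorphism.
      exact ⟨Quotient.mk _ S, (TopExtension.IsIso.mk_eq_mk (.refl S.1) S.2 (hσ S) (hσr S) hτ hτr
        (hF S) hF').trans hc⟩
  refine ⟨Equiv.ofBijective φ hφ, fun S => ⟨⟨σ S, hσ S, hσr S⟩, fun τ hτ hτr => ?_⟩⟩
  obtain ⟨F', hF'⟩ := TopExtension.exists_factorSet S.2 hτ hτr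
  exact ⟨F', hF', TopExtension.IsIso.mk_eq_mk (.refl S.1) S.2 (hσ S) (hσr S) hτ hτr (hF S) hF'⟩
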